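/- All spaces are assumed to be $T_3$ (regular and Hausdorff). A *Michael space* is a Lindelöf space whose product with the space $\mathbb{P}\subset\mathbb{R}$ of irrational numbers is not Lindelöf. A space is *productively Lindelöf* if its product with every Lindelöf space is Lindelöf. A space is *Čech-complete* if it is Tychonoff and is a $G_\delta$ subset of its Stone–Čech compactification. A space is *$K$-analytic* if it is the continuous image of a Lindelöf Čech-complete space. A space is *projectively $\sigma$-compact* if each of its continuous images in a separable metrizable space is $\sigma$-compact. **Theorem.** If there is a Michael space, then every productively Lindelöf $K$-analytic space is projectively $\sigma$-compact. -/

import Mathlib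

open Set Topology TopologicalSpace

universe u v w z

/-- A Michael space: a `T₃` Lindelöf space whose product with the space of irrationals
(with its subspace topology from `ℝ`) is not Lindelöf. -/
structure IsMichaelSpace (M : Type w) [TopologicalSpace M] : Prop where
  t3 : T3Space M
  lindelof : LindelofSpace M
  not_lindelof_prod : ¬ LindelofSpace (M × {x : ℝ // Irrational x})

/-- A space is productively Lindelöf if its product with every (`T₃`) Lindelöf space
is Lindelöf. -/
def ProductivelyLindelof (Y : Type u) [TopologicalSpace Y] : Prop :=
  ∀ (L : Type w) [TopologicalSpace L] [T3Space L] [LindelofSpace L], LindelofSpace (Y × L)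

/-- A space is Čech-complete if it is Tychonoff and is a `Gδ` set in its Stone–Čech
compactification. -/
structure IsCechComplete (X : Type v) [TopologicalSpace X] : Prop where
  t35 : T35Space X
  isGδ_range : IsGδ (range (stoneCechUnit : X → StoneCech X))

/-- A space is K-analytic if it is a continuous image of a Lindelöf Čech-complete space. -/
def IsKAnalytic (Y : Type u) [TopologicalSpace Y] : Prop :=
  ∃ (X : Type v) (_ : TopologicalSpace X),
    LindelofSpace X ∧ IsCechComplete X ∧ ∃ g : X → Y, Continuous g ∧ Function.Surjective g

/-- A space is projectively σ-compact if each of its continuous images in a separable metrizable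
space is σ-compact. -/
def ProjectivelySigmaCompact (Y : Type u) [TopologicalSpace Y] : Prop :=
  ∀ (Z : Type z) [TopologicalSpace Z] [MetrizableSpace Z] [SeparableSpace Z] (f : Y → Z),
    Continuous f → IsSigmaCompact (range f)

/-!
Let `f : Y → Z` be continuous with `Z` separable metrizable, and put `A = range f`. Since `Y` is a
continuous image of a Lindelöf Čech-complete space `X`, the set `A` is a continuous image of `X`,
and hence it is analytic (`IsCechComplete.analyticSet_range`): write
`X` as the intersection of open sets `G n` of its Stone–Čech compactification, and for each `n`
cover `X` by countably many sets whose closures there lie in `G n` and whose images in `A` have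
diameter at most `1 / (n + 1)`. By compactness, the sequences of choices, one from each cover, with
nonempty finite intersections form a closed subset of the Baire space that parametrises `A`.

Suppose that `A` is not σ-compact. A Hurewicz-type construction
(`exists_isProperMap_surjective_of_not_isSigmaCompactlyCovered`) then produces a set
`T ⊆ A × (ℕ → ℕ)` that projects properly to `A` and onto `ℕ → ℕ`. It rests on the following:
if `E` is a closed subset of the parametrising Polish space and its image lies in no σ-compact
subset of `A`, then the points of `E` near which this persists have an image whose closure is not
compact, so some continuous real function `p` on `A` is unbounded there; near points where `p ≥ n`
one finds smaller closed sets of the same kind. Iterating gives functions `p l` indexed by finite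
sequences, and `T` consists of the pairs `(a, α)` with `α k ≤ p (α 0, …, α (k - 1)) a` for all `k`.

Finally, if `Y` is productively Lindelöf and `M` is a Michael space, then `Y × M` is Lindelöf, hence
so are its image `A × M`, the proper preimage `T × M` (`IsProperMap.lindelofSpace`), and the images
`(ℕ → ℕ) × M` and `{x : ℝ // Irrational x} × M` of the latter, a contradiction.
-/

open Filter MeasureTheory
open scoped ENNReal

/-! ### Lindelöf spaces and proper maps -/

theorem IsProperMap.lindelofSpace {S B : Type*} [TopologicalSpace S] [TopologicalSpace B]
    [LindelofSpace B] {f : S → B} (hf : IsProperMap f) : LindelofSpace S := by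
  refine ⟨fun 𝓕 _ _ _ ↦ ?_⟩
  obtain ⟨y, hy⟩ := cluster_point_of_Lindelof (map f 𝓕)
  obtain ⟨x, -, hx⟩ := hf.clusterPt_of_mapClusterPt hy
  exact ⟨x, mem_univ x, hx⟩

/-! ### Continuous images of Lindelöf Čech-complete spaces -/

/-- As `0⁻¹ = ∞` in `ℝ≥0∞`, the bound is void for the empty sequence. -/
theorem vanishingDiam_of_ediam_le {α β : Type*} [PseudoMetricSpace α] {A : List β → Set α}
    (h : ∀ l, Metric.ediam (A l) ≤ (l.length : ℝ≥0∞)⁻¹) : CantorScheme.VanishingDiam A := by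
  intro x
  refine tendsto_of_tendsto_of_tendsto_of_le_of_le tendsto_const_nhds
    ENNReal.tendsto_inv_nat_nhds_zero (fun _ ↦ zero_le) fun n ↦ ?_
  simpa using h (PiNat.res x n)

theorem res_congr {β : Type*} {x y : ℕ → β} {n : ℕ} (h : ∀ k < n, x k = y k) :
    PiNat.res x n = PiNat.res y n :=
  PiNat.res_eq_res.2 fun {m} hm ↦ h m hm

/-- In the scheme `W l` of finite intersections built from a sequence of countable covers, the
closures of the `W l` in the Stone–Čech compactification along a branch have a common point, which
lies in `X` because the `n`-th cover refines the `n`-th open set of a `Gδ` representation. -/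
theorem IsCechComplete.analyticSet_range {X Z : Type*} [TopologicalSpace X] [LindelofSpace X]
    (hX : IsCechComplete X) [TopologicalSpace Z] [MetrizableSpace Z] {h : X → Z}
    (hh : Continuous h) : AnalyticSet (range h) := by
  let := metrizableSpaceMetric Z
  have := hX.t35
  set e : X → StoneCech X := stoneCechUnit
  have hemb : IsEmbedding e := isEmbedding_stoneCechUnit
  obtain ⟨G, hGo, hG⟩ := hX.isGδ_range.eq_iInter_nat
  have hcover : ∀ n : ℕ, ∃ V : ℕ → Set X, (⋃ i, V i) = univ ∧
      ∀ i, closure (e '' V i) ⊆ G n ∧ Metric.ediam (h '' V i) ≤ ((n + 1 : ℕ) : ℝ≥0∞)⁻¹ := by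
    intro n
    have hloc : ∀ x : X, ∃ V ∈ 𝓝 x, closure (e '' V) ⊆ G n ∧
        Metric.ediam (h '' V) ≤ ((n + 1 : ℕ) : ℝ≥0∞)⁻¹ := by
      intro x
      have hx : G n ∈ 𝓝 (e x) := (hGo n).mem_nhds <| by
        have : e x ∈ ⋂ n, G n := hG ▸ mem_range_self x
        exact mem_iInter.1 this n
      obtain ⟨K, hK, hKc, hKG⟩ := exists_mem_nhds_isClosed_subset hx
      have hpos : (0 : ℝ≥0∞) < ((n + 1 : ℕ) : ℝ≥0∞)⁻¹ / 2 :=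
        ENNReal.half_pos (ENNReal.inv_ne_zero.2 (ENNReal.natCast_ne_top _))
      refine ⟨e ⁻¹' K ∩ h ⁻¹' Metric.eball (h x) (((n + 1 : ℕ) : ℝ≥0∞)⁻¹ / 2),
        inter_mem (hemb.continuous.continuousAt hK)
          (hh.continuousAt (Metric.eball_mem_nhds _ hpos)), ?_, ?_⟩
      · refine (closure_minimal ?_ hKc).trans hKG
        rintro _ ⟨y, hy, rfl⟩
        exact hy.1
      · calc Metric.ediam _ ≤ Metric.ediam (Metric.eball (h x) (((n + 1 : ℕ) : ℝ≥0∞)⁻¹ / 2)) := by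
              refine Metric.ediam_mono ?_
              rintro _ ⟨y, hy, rfl⟩
              exact hy.2
          _ ≤ 2 * (((n + 1 : ℕ) : ℝ≥0∞)⁻¹ / 2) := Metric.ediam_eball_le
          _ = _ := ENNReal.mul_div_cancel (by simp) (by simp)
    choose V hV hVG hVd using hloc
    obtain ⟨t, htc, ht⟩ := countable_cover_nhds hV
    rcases t.eq_empty_or_nonempty with rfl | hne
    · refine ⟨fun _ ↦ ∅, ?_, by simp⟩
      simpa using ht
    · obtain ⟨g, rfl⟩ := htc.exists_eq_range hne
      exact ⟨fun i ↦ V (g i), by simpa using ht, fun i ↦ ⟨hVG _, hVd _⟩⟩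
  choose V hVu hV using hcover
  let W : List ℕ → Set X := fun l ↦ l.rec univ fun n l W ↦ V l.length n ∩ W
  have hWcons : ∀ n l, W (n :: l) = V l.length n ∩ W l := fun _ _ ↦ rfl
  let A : List ℕ → Set Z := fun l ↦ closure (h '' W l) ∩ range h
  have hdiam : CantorScheme.VanishingDiam A := by
    refine vanishingDiam_of_ediam_le fun l ↦ ?_
    refine (Metric.ediam_mono inter_subset_left).trans ?_
    rw [Metric.ediam_closure]
    cases l with
    | nil => simp
    | cons n l =>
      exact (Metric.ediam_mono (image_mono inter_subset_left)).trans (hV l.length n).2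
  have hdom : (CantorScheme.inducedMap A).1 = {α | ∀ n, (W (PiNat.res α n)).Nonempty} := by
    ext α
    constructor
    · rintro ⟨z, hz⟩ n
      have := (mem_iInter.1 hz n).1
      exact (closure_nonempty_iff.1 ⟨z, this⟩).of_image
    · intro hα
      obtain ⟨y, hy⟩ := IsCompact.nonempty_iInter_of_sequence_nonempty_isCompact_isClosed
        (fun n ↦ closure (e '' W (PiNat.res α n)))
        (fun n ↦ closure_mono (image_mono inter_subset_right))
        (fun n ↦ ((hα n).image e).closure) isClosed_closure.isCompact fun _ ↦ isClosed_closure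
      have hyW := mem_iInter.1 hy
      have hyG : y ∈ range e := by
        rw [hG]
        exact mem_iInter.2 fun n ↦ (hV n (α n)).1 <| by
          have := closure_mono (image_mono inter_subset_left) (hyW (n + 1))
          simpa using this
      obtain ⟨x, rfl⟩ := hyG
      refine ⟨h x, mem_iInter.2 fun n ↦ ⟨?_, mem_range_self x⟩⟩
      refine image_closure_subset_closure_image hh (mem_image_of_mem h ?_)
      rw [hemb.closure_eq_preimage_closure_image]
      exact hyW n
  have hclosed : IsClosed (CantorScheme.inducedMap A).1 := by
    rw [hdom, ofPred_forall]
    refine isClosed_iInter fun n ↦ ⟨isOpen_iff_mem_nhds.2 fun α hα ↦ ?_⟩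
    filter_upwards [(PiNat.isOpen_cylinder _ α n).mem_nhds (PiNat.self_mem_cylinder α n)] with β hβ
    have : PiNat.res β n = PiNat.res α n := res_congr hβ
    change ¬ (W (PiNat.res β n)).Nonempty
    rw [this]
    exact hα
  have hrange : range (CantorScheme.inducedMap A).2 = range h := by
    refine Subset.antisymm (range_subset_iff.2 fun α ↦ (CantorScheme.map_mem α 0).2) ?_
    rintro _ ⟨x, rfl⟩
    have hex : ∀ n, ∃ i, x ∈ V n i := fun n ↦ mem_iUnion.1 (hVu n ▸ mem_univ x)
    choose α hα using hex
    have hxW : ∀ n, x ∈ W (PiNat.res α n) := by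
      intro n
      induction n with
      | zero => exact mem_univ x
      | succ n ih => exact ⟨by simpa using hα n, ih⟩
    have hxA : ∀ n, h x ∈ A (PiNat.res α n) := fun n ↦
      ⟨subset_closure (mem_image_of_mem h (hxW n)), mem_range_self x⟩
    refine ⟨⟨α, h x, mem_iInter.2 hxA⟩, ?_⟩
    refine eq_of_forall_dist_le fun ε hε ↦ ?_
    obtain ⟨n, hn⟩ := hdiam.dist_lt ε hε α
    exact (hn _ (CantorScheme.map_mem _ n) _ (hxA n)).le
  rw [← hrange]
  have := hclosed.polishSpace
  exact analyticSet_range_of_polishSpace hdiam.map_continuous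

/-! ### Unbounded functions on sets without compact closure -/

theorem exists_continuousMap_not_bddAbove_image {A : Type*} [MetricSpace A] {S : Set A}
    (hS : ¬ IsCompact (closure S)) : ∃ p : C(A, ℝ), ¬ BddAbove (p '' S) := by
  rw [isCompact_iff_isSeqCompact, IsSeqCompact] at hS
  push Not at hS
  obtain ⟨y, hyS, hy⟩ := hS
  have hlocal : ∀ x, ∃ m : ℕ, x ∉ closure (y '' Ici m) := by
    intro x
    by_contra! hx
    have hcl : MapClusterPt x atTop y := by
      refine mapClusterPt_iff_frequently.2 fun s hs ↦ frequently_atTop.2 fun m ↦ ?_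
      obtain ⟨_, hz, k, hk, rfl⟩ := mem_closure_iff_nhds.1 (hx m) s hs
      exact ⟨k, hk, hz⟩
    obtain ⟨g, hg, hlim⟩ := hcl.tendsto_subseq
    exact hy x (isClosed_closure.mem_of_tendsto hlim (Eventually.of_forall fun n ↦ hyS _)) g hg hlim
  -- The tails of `y` form a decreasing sequence of closed sets with empty intersection, so a
  -- continuous function can dominate the number of tails containing a point.
  obtain ⟨p, hp⟩ := exists_continuous_forall_mem_convex_of_local_const
    (t := fun x : A ↦ {r : ℝ | ∀ n : ℕ, x ∈ closure (y '' Ici n) → (n : ℝ) ≤ r})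
    (fun x ↦ by
      simp only [ofPred_forall]
      exact convex_iInter fun n ↦ convex_iInter fun _ ↦ convex_Ici _)
    (fun x ↦ by
      obtain ⟨m, hm⟩ := hlocal x
      refine ⟨m, ?_⟩
      filter_upwards [isClosed_closure.isOpen_compl.mem_nhds hm] with z hz n hn
      by_contra! hlt
      exact hz (closure_mono (image_mono (Ici_subset_Ici.2 (by exact_mod_cast hlt.le))) hn))
  refine ⟨p, fun ⟨B, hB⟩ ↦ ?_⟩
  have hsub : closure S ⊆ p ⁻¹' Iic B :=
    closure_minimal (fun x hx ↦ hB (mem_image_of_mem p hx)) (isClosed_Iic.preimage p.continuous)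
  obtain ⟨n, hn⟩ := exists_nat_gt B
  have h1 : (n : ℝ) ≤ p (y n) := hp (y n) n (subset_closure ⟨n, self_mem_Ici, rfl⟩)
  have h2 : p (y n) ≤ B := hsub (hyS n)
  linarith

/-! ### Sets whose image is covered by a σ-compact set -/

/-- The image of `E` under `φ` is contained in some σ-compact set. -/
def IsSigmaCompactlyCovered {X A : Type*} [TopologicalSpace A] (φ : X → A) (E : Set X) : Prop :=
  ∃ S : Set A, IsSigmaCompact S ∧ φ '' E ⊆ S

section SigmaCompactlyCovered

variable {X A : Type*} [TopologicalSpace A] {φ : X → A}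

theorem IsSigmaCompactlyCovered.mono {E F : Set X} (hF : IsSigmaCompactlyCovered φ F)
    (h : E ⊆ F) : IsSigmaCompactlyCovered φ E :=
  let ⟨S, hS, hFS⟩ := hF
  ⟨S, hS, (image_mono h).trans hFS⟩

theorem IsSigmaCompactlyCovered.biUnion {ι : Type*} {t : Set ι} (ht : t.Countable)
    {E : ι → Set X} (h : ∀ i ∈ t, IsSigmaCompactlyCovered φ (E i)) :
    IsSigmaCompactlyCovered φ (⋃ i ∈ t, E i) := by
  choose! S hS hES using h
  refine ⟨⋃ i ∈ t, S i, isSigmaCompact_biUnion ht hS, ?_⟩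
  rw [image_iUnion₂]
  exact iUnion₂_mono hES

theorem IsSigmaCompactlyCovered.union {E F : Set X} (hE : IsSigmaCompactlyCovered φ E)
    (hF : IsSigmaCompactlyCovered φ F) : IsSigmaCompactlyCovered φ (E ∪ F) := by
  have := IsSigmaCompactlyCovered.biUnion (φ := φ) (t := univ) (E := fun b : Bool ↦ cond b E F)
    countable_univ (by simp [hE, hF])
  exact this.mono (by simp [union_eq_iUnion])

end SigmaCompactlyCovered

/-- The branching step of the Hurewicz-type construction: a closed set that is not σ-compactly
covered contains arbitrarily small closed sets `W n` of the same kind, whose images escape to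
infinity in the sense of a continuous real function. -/
theorem exists_escaping_closed_subsets {X A : Type*} [MetricSpace X] [SecondCountableTopology X]
    [MetricSpace A] {φ : X → A} (hφ : Continuous φ) {E : Set X} (hEc : IsClosed E)
    (hE : ¬ IsSigmaCompactlyCovered φ E) {ε : ℝ≥0∞} (hε : ε ≠ 0) :
    ∃ (p : C(A, ℝ)) (W : ℕ → Set X), ∀ n, (IsClosed (W n) ∧ ¬ IsSigmaCompactlyCovered φ (W n)) ∧
      W n ⊆ E ∧ Metric.ediam (W n) ≤ ε ∧ ∀ x ∈ W n, (n : ℝ) ≤ p (φ x) := by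
  -- The kernel of `E`: the points all of whose neighbourhoods in `E` are large.
  set C : Set X := {x ∈ E | ∀ U ∈ 𝓝 x, ¬ IsSigmaCompactlyCovered φ (U ∩ E)}
  have hEC : IsSigmaCompactlyCovered φ (E \ C) := by
    have hex : ∀ x ∈ E \ C, ∃ U ∈ 𝓝 x, IsSigmaCompactlyCovered φ (U ∩ E) := by
      rintro x ⟨hxE, hxC⟩
      by_contra! hx
      exact hxC ⟨hxE, hx⟩
    choose! U hU hUs using hex
    obtain ⟨t, hts, htc, ht⟩ := countable_cover_nhdsWithin
      fun x hx ↦ mem_nhdsWithin_of_mem_nhds (hU x hx)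
    refine (IsSigmaCompactlyCovered.biUnion htc fun x hx ↦ hUs x (hts hx)).mono fun x hx ↦ ?_
    obtain ⟨i, hi, hxi⟩ := mem_iUnion₂.1 (ht hx)
    exact mem_iUnion₂.2 ⟨i, hi, hxi, hx.1⟩
  have hnc : ¬ IsCompact (closure (φ '' C)) := fun hcomp ↦
    hE <| (hEC.union ⟨_, hcomp.isSigmaCompact, subset_closure⟩).mono (by simp)
  obtain ⟨p, hp⟩ := exists_continuousMap_not_bddAbove_image hnc
  have hpt : ∀ n : ℕ, ∃ x ∈ C, (n : ℝ) < p (φ x) := by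
    intro n
    obtain ⟨_, ⟨_, ⟨x, hx, rfl⟩, rfl⟩, hlt⟩ := not_bddAbove_iff.1 hp n
    exact ⟨x, hx, hlt⟩
  choose x hxC hx using hpt
  have hball : ∀ n, ∃ K ∈ 𝓝 (x n), IsClosed K ∧
      K ⊆ Metric.eball (x n) (ε / 2) ∩ {z | (n : ℝ) < p (φ z)} := fun n ↦
    exists_mem_nhds_isClosed_subset <| inter_mem
      (Metric.eball_mem_nhds _ (ENNReal.half_pos hε))
      ((isOpen_lt continuous_const (p.continuous.comp hφ)).mem_nhds (hx n))
  choose K hK hKc hKs using hball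
  refine ⟨p, fun n ↦ K n ∩ E, fun n ↦ ⟨⟨(hKc n).inter hEc, (hxC n).2 _ (hK n)⟩,
    inter_subset_right, ?_, fun z hz ↦ (hKs n hz.1).2.le⟩⟩
  calc Metric.ediam (K n ∩ E) ≤ Metric.ediam (Metric.eball (x n) (ε / 2)) :=
        Metric.ediam_mono fun z hz ↦ (hKs n hz.1).1
    _ ≤ 2 * (ε / 2) := Metric.ediam_eball_le
    _ = ε := ENNReal.mul_div_cancel (by simp) (by simp)

/-! ### Proper correspondences onto the Baire space -/

/-- For a family of continuous functions indexed by finite sequences, the pairs `(a, α)` such that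
each `α k` is bounded by the value at `a` of the function attached to the first `k` terms of `α`. -/
def boundedBranches {A : Type*} [TopologicalSpace A] (p : List ℕ → C(A, ℝ)) :
    Set (A × (ℕ → ℕ)) :=
  {q | ∀ k, (q.2 k : ℝ) ≤ p (PiNat.res q.2 k) q.1}

/-- Near a point `a`, the bounds on the coordinates of `α` take only finitely many values once the
earlier coordinates are fixed, so each coordinate is constant along an ultrafilter over `a`. -/
theorem isProperMap_fst_boundedBranches {A : Type*} [TopologicalSpace A]
    (p : List ℕ → C(A, ℝ)) : IsProperMap fun q : boundedBranches p ↦ q.1.1 := by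
  refine isProperMap_iff_ultrafilter.2
    ⟨continuous_fst.comp continuous_subtype_val, fun 𝒰 a ha ↦ ?_⟩
  have hcoord : ∀ k u, (∀ᶠ q in (𝒰 : Filter (boundedBranches p)), PiNat.res q.1.2 k = u) →
      ∃ n, ∀ᶠ q in (𝒰 : Filter (boundedBranches p)), q.1.2 k = n := by
    intro k u hu
    obtain ⟨N, hN⟩ := exists_nat_gt (p u a)
    have hev : ∀ᶠ q in (𝒰 : Filter (boundedBranches p)), ∃ n ∈ Iio N, q.1.2 k = n := by
      filter_upwards [hu, (((p u).continuous.tendsto a).comp ha).eventually_lt_const hN]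
        with q hq hlt
      refine ⟨_, ?_, rfl⟩
      have := q.2 k
      rw [hq] at this
      exact_mod_cast this.trans_lt hlt
    obtain ⟨n, -, hn⟩ := (Ultrafilter.eventually_exists_mem_iff (finite_Iio N)).1 hev
    exact ⟨n, hn⟩
  have hres : ∀ k, ∃ u, ∀ᶠ q in (𝒰 : Filter (boundedBranches p)), PiNat.res q.1.2 k = u := by
    intro k
    induction k with
    | zero => exact ⟨[], Eventually.of_forall fun _ ↦ rfl⟩
    | succ k ih =>
      obtain ⟨u, hu⟩ := ih
      obtain ⟨n, hn⟩ := hcoord k u hu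
      refine ⟨n :: u, ?_⟩
      filter_upwards [hu, hn] with q h1 h2
      rw [PiNat.res_succ, h1, h2]
  have hval : ∀ k, ∃ n, ∀ᶠ q in (𝒰 : Filter (boundedBranches p)), q.1.2 k = n := fun k ↦
    let ⟨u, hu⟩ := hres k
    hcoord k u hu
  choose β hβ using hval
  have hresβ : ∀ k, ∀ᶠ q in (𝒰 : Filter (boundedBranches p)),
      PiNat.res q.1.2 k = PiNat.res β k := by
    intro k
    filter_upwards [(finite_Iio k).eventually_all.2 fun i _ ↦ hβ i] with q hq
    exact res_congr fun i hi ↦ hq i hi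
  have hmem : (a, β) ∈ boundedBranches p := by
    intro k
    refine ge_of_tendsto (((p (PiNat.res β k)).continuous.tendsto a).comp ha) ?_
    filter_upwards [hβ k, hresβ k] with q h1 h2
    have := q.2 k
    rwa [h1, h2] at this
  refine ⟨⟨(a, β), hmem⟩, rfl, ?_⟩
  have hlim : Tendsto (fun q : boundedBranches p ↦ q.1) 𝒰 (𝓝 (a, β)) := by
    refine ha.prodMk_nhds (tendsto_pi_nhds.2 fun k ↦ ?_)
    exact tendsto_const_nhds.congr' ((hβ k).mono fun q hq ↦ hq.symm)
  exact tendsto_id'.1 (tendsto_subtype_rng.2 hlim)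

/-- A Hurewicz-type theorem: if a continuous image of a Polish space lies in no σ-compact subset of
the metric space `A`, then `A` is in proper correspondence with the whole Baire space. -/
theorem exists_isProperMap_surjective_of_not_isSigmaCompactlyCovered {X A : Type*}
    [TopologicalSpace X] [PolishSpace X] [MetricSpace A] {φ : X → A} (hφ : Continuous φ)
    (h : ¬ IsSigmaCompactlyCovered φ univ) :
    ∃ T : Set (A × (ℕ → ℕ)), IsProperMap (fun q : T ↦ q.1.1) ∧
      Function.Surjective fun q : T ↦ q.1.2 := by
  let := upgradeIsCompletelyMetrizable X
  let State := {E : Set X // IsClosed E ∧ ¬ IsSigmaCompactlyCovered φ E}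
  have hstep : ∀ (E : State) (k : ℕ), ∃ (p : C(A, ℝ)) (W : ℕ → State), ∀ n, (W n).1 ⊆ E.1 ∧
      Metric.ediam (W n).1 ≤ ((k + 1 : ℕ) : ℝ≥0∞)⁻¹ ∧ ∀ x ∈ (W n).1, (n : ℝ) ≤ p (φ x) := by
    intro E k
    obtain ⟨p, W, hW⟩ := exists_escaping_closed_subsets hφ E.2.1 E.2.2
      (ENNReal.inv_ne_zero.2 (ENNReal.natCast_ne_top (k + 1)))
    exact ⟨p, fun n ↦ ⟨W n, (hW n).1⟩, fun n ↦ (hW n).2⟩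
  choose p W hWsub hWdiam hWp using hstep
  let D : List ℕ → State := fun l ↦ l.rec ⟨univ, isClosed_univ, h⟩ fun n l E ↦ W E l.length n
  have hanti : CantorScheme.ClosureAntitone fun l ↦ (D l).1 :=
    CantorScheme.Antitone.closureAntitone (fun l n ↦ hWsub (D l) l.length n) fun l ↦ (D l).2.1
  have hdiam : CantorScheme.VanishingDiam fun l ↦ (D l).1 := by
    refine vanishingDiam_of_ediam_le fun l ↦ ?_
    cases l with
    | nil => simp
    | cons n l => exact hWdiam (D l) l.length n
  have hne : ∀ l, (D l).1.Nonempty := by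
    intro l
    by_contra hemp
    refine (D l).2.2 ⟨∅, isSigmaCompact_empty, ?_⟩
    simp [not_nonempty_iff_eq_empty.1 hemp]
  have htot := hanti.map_of_vanishingDiam hdiam hne
  refine ⟨boundedBranches fun l ↦ p (D l) l.length, isProperMap_fst_boundedBranches _, fun α ↦ ?_⟩
  obtain ⟨x, hx⟩ : (⋂ n, (D (PiNat.res α n)).1).Nonempty := by
    have : α ∈ (CantorScheme.inducedMap fun l ↦ (D l).1).1 := htot ▸ mem_univ α
    exact this
  refine ⟨⟨(φ x, α), fun k ↦ ?_⟩, rfl⟩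
  exact hWp (D (PiNat.res α k)) _ (α k) x (mem_iInter.1 hx (k + 1))

/-! ### Products with analytic spaces -/

theorem exists_continuous_surjective_irrational :
    ∃ g : (ℕ → ℕ) → {x : ℝ // Irrational x}, Continuous g ∧ Function.Surjective g := by
  have hA : AnalyticSet {x : ℝ | Irrational x} :=
    IsGδ.setOfPred_irrational.measurableSet.analyticSet
  rw [AnalyticSet] at hA
  rcases hA with hA | ⟨g, hg, hr⟩
  · exact absurd (show Real.sqrt 2 ∈ {x : ℝ | Irrational x} from irrational_sqrt_two) (by simp [hA])
  · refine ⟨fun α ↦ ⟨g α, hr.subset (mem_range_self α)⟩, hg.subtype_mk _, fun ⟨x, hx⟩ ↦ ?_⟩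
    obtain ⟨α, rfl⟩ := hr.superset hx
    exact ⟨α, rfl⟩

/-- If the product of an analytic set with `M` is Lindelöf, but the product of the irrationals
with `M` is not, then the set is σ-compact. -/
theorem MeasureTheory.AnalyticSet.isSigmaCompact_of_lindelofSpace_prod {Z M : Type*}
    [TopologicalSpace Z] [MetrizableSpace Z] [TopologicalSpace M] {A : Set Z}
    (hA : AnalyticSet A) [LindelofSpace (A × M)]
    (hM : ¬ LindelofSpace (M × {x : ℝ // Irrational x})) : IsSigmaCompact A := by
  obtain ⟨P, _, _, φ, hφ, rfl⟩ := analyticSet_iff_exists_polishSpace_range.1 hA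
  let := metrizableSpaceMetric Z
  by_contra hns
  have hlarge : ¬ IsSigmaCompactlyCovered (rangeFactorization φ) univ := by
    rintro ⟨S, hS, hsub⟩
    have hSu : S = univ := by
      rwa [image_univ, rangeFactorization_surjective.range_eq, univ_subset_iff] at hsub
    rw [hSu] at hS
    exact hns (isSigmaCompact_iff_isSigmaCompact_univ.2 hS)
  obtain ⟨T, hT, hsurj⟩ :=
    exists_isProperMap_surjective_of_not_isSigmaCompactlyCovered
      (hφ.subtype_mk mem_range_self) hlarge
  have : LindelofSpace (T × M) := (hT.prodMap (isProperMap_id (X := M))).lindelofSpace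
  obtain ⟨g, hg, hgs⟩ := exists_continuous_surjective_irrational
  refine hM (LindelofSpace.of_continuous_surjective
    (f := fun q : T × M ↦ (q.2, g q.1.1.2)) (by fun_prop) ?_)
  rintro ⟨m, x⟩
  obtain ⟨α, rfl⟩ := hgs x
  obtain ⟨t, rfl⟩ := hsurj α
  exact ⟨(t, m), rfl⟩

theorem mainTheorem7
    (hM : ∃ (M : Type w) (_ : TopologicalSpace M), IsMichaelSpace M)
    (Y : Type u) [TopologicalSpace Y] [T3Space Y]
    (hY : ProductivelyLindelof.{u, w} Y) (hK : IsKAnalytic.{u, v} Y) :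
    ProjectivelySigmaCompact.{u, z} Y := by
  intro Z _ _ _ f hf
  obtain ⟨M, _, hM⟩ := hM
  obtain ⟨X, _, _, hX, g, hg, hgs⟩ := hK
  have := hM.t3
  have := hM.lindelof
  have : LindelofSpace (Y × M) := hY M
  have hA : AnalyticSet (range f) := by
    rw [← hgs.range_comp f]
    exact hX.analyticSet_range (hf.comp hg)
  have : LindelofSpace (range f × M) := LindelofSpace.of_continuous_surjective
    (f := Prod.map (rangeFactorization f) id)
    ((hf.subtype_mk mem_range_self).prodMap continuous_id)
    (rangeFactorization_surjective.prodMap Function.surjective_id)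
  exact hA.isSigmaCompact_of_lindelofSpace_prod hM.not_lindelof_prod
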